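/- Fix a set $\mathrm{Act}$ of actions with a distinguished element $\tau$, and a set $\mathbf{AP}$ of atomic propositions. **Systems.** An LTS is a set $S$ with a relation ${\to}\subseteq S\times\mathrm{Act}\times S$; an L²TS has in addition a labelling $\mathcal L:S\to\mathcal P(\mathbf{AP})$; a Kripke structure has a labelling and an unlabelled relation ${\to}\subseteq S\times S$. An L²TS has an associated LTS (forget $\mathcal L$) and an associated Kripke structure (forget the actions). It is *consistent* if (i) $s\xrightarrow{a}t$ implies ($\mathcal L(s)=\mathcal L(t)$ iff $a=\tau$); (ii) $s\xrightarrow{a}t$, $s'\xrightarrow{a}t'$ and $\mathcal L(s)=\mathcal L(s')$ imply $\mathcal L(t)=\mathcal L(t')$; (iii) $s\xrightarrow{a}t$, $s'\xrightarrow{b}t'$, $\mathcal L(s)=\mathcal L(s')$ and $\mathcal L(t)=\mathcal L(t')$ imply $a=b$. A path is *maximal* if it is infinite or ends in a state without outgoing transitions. **Bisimulations.** For a colouring $\mathcal C$ (a function on the states of an LTS) and a path $\pi=s_0,a_1,s_1,a_2,\dots$, the coloured trace $\mathcal C(\pi)$ of $s_0$ is obtained from $\mathcal C(s_0),a_1,\mathcal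 C(s_1),a_2,\dots$ by contracting all maximal finite subsequences $C,\tau,C,\dots,\tau,C$ and all infinite ones $C,\tau,C,\tau,\dots$ to $C$. It is *complete* if $\pi$ is maximal, and *divergent* if it is finite while $\pi$ is infinite. $\mathcal C$ is [fully] consistent if states of the same colour have the same [complete] coloured traces, and preserves divergence if states of the same colour have the same divergent coloured traces. States $s,t$ of an LTS are branching bisimilar, divergence sensitive branching bisimilar, or branching bisimilar with explicit divergence (written $s\approx_b^\Delta t$), if $\mathcal C(s)=\mathcal C(t)$ for some colouring $\mathcal C$ that is consistent, fully consistent, or consistent and divergence preserving, respectively. On an L²TS each of these relations means: equal labels, and related in the associated LTS. **Transformations.** An *LTS-to-L²TS transformation* $\eta$ maps every LTS $L$ to a consistent L²TS $\eta(L)$, and every state $s$ of $L$ to a state $\eta(s)$ of $\eta(L)$, such that for each of the three relations $\sim$ above and all states $s,t$ of $L$: $s\sim t$ iff $\eta(s)\sim\eta(t)$. **Logic.** $\mathsf{CTL}^*_{-\mathsf X}$ state formulas $\varphi$ and path formulas $\psi$ are generated by $\varphi::=p\mid\neg\varphi\mid\bigwedge_{i\in I}\varphi_i\mid\exists\psi$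 and $\psi::=\varphi\mid\neg\psi\mid\bigwedge_{i\in I}\psi_i\mid\psi\,\mathsf U\,\psi$, with $p$ an atomic proposition and $I$ an arbitrary set. Validity in a state of a Kripke structure, or on a maximal path, is as usual: $\exists\psi$ holds in $s$ iff $\psi$ holds on some maximal path from $s$; a state formula holds on a path iff it holds in its first state; $\psi\,\mathsf U\,\psi'$ holds on a path iff for some position $k$ on it $\psi'$ holds on the suffix from $k$ and $\psi$ holds on the suffix from $j$ for every $j<k$. The *deadlock extension* $D(K)$ of a Kripke structure $K$ is the total Kripke structure, over $\mathbf{AP}\cup\{\delta\}$ with $\delta\notin\mathbf{AP}$, that arises by adding a fresh state $s_\delta$ with label $\{\delta\}$ and a transition to $s_\delta$ from $s_\delta$ itself and from every state of $K$ without outgoing transitions. For a state $s$ of an LTS $L$ and a formula $\varphi$ over $\mathbf{AP}\cup\{\delta\}$, write $s\models^{D\circ\eta}\varphi$ if $\varphi$ is valid in the state $\eta(s)$ of $D(\eta(L))$, where $\eta(L)$ also denotes its associated Kripke structure. **Theorem.** Let $\eta$ be an LTS-to-L²TS transformation and let $s,t$ be states of an LTS $L$. Then $$s\approx_b^\Delta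 t\iff\bigl(s\models^{D\circ\eta}\varphi\Leftrightarrow t\models^{D\circ\eta}\varphi\ \text{ for all }\mathsf{CTL}^*_{-\mathsf X}\text{ state formulas }\varphi\text{ over }\mathbf{AP}\cup\{\delta\}\bigr).$$ Moreover, if $\kappa$ is an infinite cardinal such that from every state of $D(\eta(L))$ fewer than $\kappa$ states are reachable, the same equivalence holds with $\varphi$ ranging only over the formulas in which every conjunction has fewer than $\kappa$ conjuncts. -/

import Mathlib

universe u v a p

namespace DeadlockCTL

/-! ### Labelled transition systems and their coloured traces -/

/-- A labelled transition system over the set `Act` of actions. -/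
structure LTS (Act : Type a) where
  State : Type u
  Tr : State → Act → State → Prop

namespace LTS

variable {Act : Type a}

/-- A finite (`len = n`) or infinite (`len = ⊤`) path
`st 0, act 0, st 1, act 1, st 2, …` with `len` transitions.  Only the states `st k` with `k ≤ len`
and the actions `act k` with `k < len` belong to the path; all other values are ignored. -/
structure Path (L : LTS.{u} Act) where
  len : ℕ∞
  st : ℕ → L.State
  act : ℕ → Act
  step : ∀ k : ℕ, (k : ℕ∞) < len → L.Tr (st k) (act k) (st (k + 1))

/-- A path is maximal if it is infinite or its last state has no outgoing transition. -/
def Path.Maximal {L : LTS.{u} Act} (π : L.Path) : Prop :=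
  ∀ n : ℕ, π.len = n → ¬ ∃ b s', L.Tr (π.st n) b s'

/-- The `k`-th transition of the path survives the contraction: it is not a `τ`-transition between
two states of the same colour. -/
def Path.Visible {L : LTS.{u} Act} (τ : Act) {Col : Type*} (C : L.State → Col) (π : L.Path)
    (k : ℕ) : Prop :=
  (k : ℕ∞) < π.len ∧ ¬ (π.act k = τ ∧ C (π.st k) = C (π.st (k + 1)))

open Classical in
/-- The coloured trace `C(π)`: the sequence obtained from `C (st 0), act 0, C (st 1), act 1, …` by
contracting all maximal (finite or infinite) subsequences `c, τ, c, τ, …` to `c`.  It is given by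
its first colour and the (finite or infinite) sequence of the remaining pairs (action, colour);
a finite sequence is padded with `none`. -/
noncomputable def Path.trace {L : LTS.{u} Act} (τ : Act) {Col : Type*} (C : L.State → Col)
    (π : L.Path) : Col × (ℕ → Option (Act × Col)) :=
  (C (π.st 0), fun n =>
    if (n : ℕ∞) < {k | π.Visible τ C k}.encard then
      some (π.act (Nat.nth (π.Visible τ C) n), C (π.st (Nat.nth (π.Visible τ C) n + 1)))
    else none)

/-- The coloured traces of a state. -/
def traces (L : LTS.{u} Act) (τ : Act) {Col : Type*} (C : L.State → Col) (s : L.State) :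
    Set (Col × (ℕ → Option (Act × Col))) :=
  {σ | ∃ π : L.Path, π.st 0 = s ∧ π.trace τ C = σ}

/-- The complete coloured traces of a state, i.e. those of its maximal paths. -/
def completeTraces (L : LTS.{u} Act) (τ : Act) {Col : Type*} (C : L.State → Col) (s : L.State) :
    Set (Col × (ℕ → Option (Act × Col))) :=
  {σ | ∃ π : L.Path, π.st 0 = s ∧ π.Maximal ∧ π.trace τ C = σ}

/-- The divergent coloured traces of a state, i.e. the finite traces of its infinite paths. -/
def divergentTraces (L : LTS.{u} Act) (τ : Act) {Col : Type*} (C : L.State → Col) (s : L.State) :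
    Set (Col × (ℕ → Option (Act × Col))) :=
  {σ | (∃ n, σ.2 n = none) ∧ ∃ π : L.Path, π.st 0 = s ∧ π.len = ⊤ ∧ π.trace τ C = σ}

/-- Consistent colourings. -/
def Consistent (L : LTS.{u} Act) (τ : Act) {Col : Type*} (C : L.State → Col) : Prop :=
  ∀ s t, C s = C t → L.traces τ C s = L.traces τ C t

/-- Fully consistent colourings. -/
def FullyConsistent (L : LTS.{u} Act) (τ : Act) {Col : Type*} (C : L.State → Col) : Prop :=
  ∀ s t, C s = C t → L.completeTraces τ C s = L.completeTraces τ C t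

/-- Divergence preserving colourings. -/
def PreservesDivergence (L : LTS.{u} Act) (τ : Act) {Col : Type*} (C : L.State → Col) : Prop :=
  ∀ s t, C s = C t → L.divergentTraces τ C s = L.divergentTraces τ C t

/-- (Divergence blind) branching bisimulation equivalence. -/
def BranchingBisim (L : LTS.{u} Act) (τ : Act) (s t : L.State) : Prop :=
  ∃ (Col : Type u) (C : L.State → Col), L.Consistent τ C ∧ C s = C t

/-- Divergence sensitive branching bisimulation equivalence. -/
def DivSensBranchingBisim (L : LTS.{u} Act) (τ : Act) (s t : L.State) : Prop :=
  ∃ (Col : Type u) (C : L.State → Col), L.FullyConsistent τ C ∧ C s = C t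

/-- Branching bisimulation equivalence with explicit divergence. -/
def ExplDivBranchingBisim (L : LTS.{u} Act) (τ : Act) (s t : L.State) : Prop :=
  ∃ (Col : Type u) (C : L.State → Col),
    L.Consistent τ C ∧ L.PreservesDivergence τ C ∧ C s = C t

end LTS

/-! ### Kripke structures, the logic CTL* without next, and the deadlock extension -/

/-- A Kripke structure over the set `AP` of atomic propositions. -/
structure Kripke (AP : Type p) where
  State : Type v
  lab : State → Set AP
  Tr : State → State → Prop

/-- A finite (`len = n`) or infinite (`len = ⊤`) path `st 0, st 1, …` with `len` transitions.
Only the states `st k` with `k ≤ len` belong to the path; all other values are ignored. -/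
structure Kripke.Path {AP : Type p} (K : Kripke.{v} AP) where
  len : ℕ∞
  st : ℕ → K.State
  step : ∀ k : ℕ, (k : ℕ∞) < len → K.Tr (st k) (st (k + 1))

/-- A path is maximal if it is infinite or its last state has no outgoing transition. -/
def Kripke.Path.Maximal {AP : Type p} {K : Kripke.{v} AP} (π : K.Path) : Prop :=
  ∀ n : ℕ, π.len = n → ¬ ∃ s', K.Tr (π.st n) s'

/-- The suffix of a path that starts at position `k`, where `k ≤ len`. -/
def Kripke.Path.drop {AP : Type p} {K : Kripke.{v} AP} (π : K.Path) (k : ℕ) : K.Path where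
  len := π.len - k
  st i := π.st (i + k)
  step i hi := by
    have h : ((i + k : ℕ) : ℕ∞) < π.len := by
      push_cast
      exact lt_tsub_iff_right.mp hi
    have h' := π.step (i + k) h
    rwa [Nat.add_right_comm] at h'

mutual
/-- State formulas of CTL* without next.  Conjunctions range over arbitrary families
of formulas indexed by a type in the universe `v`. -/
inductive StateFormula (AP : Type p) : Type (max p (v + 1))
  | atom (q : AP) : StateFormula AP
  | neg (φ : StateFormula AP) : StateFormula AP
  | conj (ι : Type v) (φ : ι → StateFormula AP) : StateFormula AP
  | ex (ψ : PathFormula AP) : StateFormula AP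

/-- Path formulas of CTL* without next. -/
inductive PathFormula (AP : Type p) : Type (max p (v + 1))
  | state (φ : StateFormula AP) : PathFormula AP
  | neg (ψ : PathFormula AP) : PathFormula AP
  | conj (ι : Type v) (ψ : ι → PathFormula AP) : PathFormula AP
  | until (ψ ψ' : PathFormula AP) : PathFormula AP
end

mutual
/-- All conjunctions in the state formula have fewer than `κ` conjuncts. -/
def StateFormula.ConjLT {AP : Type p} (κ : Cardinal.{v}) : StateFormula.{v} AP → Prop
  | .atom _ => True
  | .neg φ => φ.ConjLT κ
  | .conj ι φ => Cardinal.mk ι < κ ∧ ∀ i, (φ i).ConjLT κ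
  | .ex ψ => ψ.ConjLT κ

/-- All conjunctions in the path formula have fewer than `κ` conjuncts. -/
def PathFormula.ConjLT {AP : Type p} (κ : Cardinal.{v}) : PathFormula.{v} AP → Prop
  | .state φ => φ.ConjLT κ
  | .neg ψ => ψ.ConjLT κ
  | .conj ι ψ => Cardinal.mk ι < κ ∧ ∀ i, (ψ i).ConjLT κ
  | .until ψ ψ' => ψ.ConjLT κ ∧ ψ'.ConjLT κ
end

mutual
/-- Validity of a state formula in a state. -/
def StateFormula.Valid {AP : Type p} {K : Kripke.{v} AP} : StateFormula.{v} AP → K.State → Prop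
  | .atom q, s => q ∈ K.lab s
  | .neg φ, s => ¬ φ.Valid s
  | .conj _ φ, s => ∀ i, (φ i).Valid s
  | .ex ψ, s => ∃ π : K.Path, π.Maximal ∧ π.st 0 = s ∧ ψ.Valid π

/-- Validity of a path formula on a (maximal) path. -/
def PathFormula.Valid {AP : Type p} {K : Kripke.{v} AP} : PathFormula.{v} AP → K.Path → Prop
  | .state φ, π => φ.Valid (π.st 0)
  | .neg ψ, π => ¬ ψ.Valid π
  | .conj _ ψ, π => ∀ i, (ψ i).Valid π
  | .until ψ ψ', π => ∃ k : ℕ, (k : ℕ∞) ≤ π.len ∧ ψ'.Valid (π.drop k) ∧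
      ∀ j < k, ψ.Valid (π.drop j)
end

/-- The deadlock extension of a Kripke structure.  The fresh state `s_δ` is `none : Option State`,
the fresh atomic proposition `δ` is `none : Option AP`. -/
def Kripke.deadlockExt {AP : Type p} (K : Kripke.{v} AP) : Kripke.{v} (Option AP) where
  State := Option K.State
  lab
    | some s => some '' K.lab s
    | none => {none}
  Tr
    | some s, some t => K.Tr s t
    | some s, none => ¬ ∃ t, K.Tr s t
    | none, some _ => False
    | none, none => True

/-! ### Doubly labelled transition systems and transformations -/

/-- A doubly labelled transition system. -/
structure L2TS (Act : Type a) (AP : Type p) where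
  State : Type v
  lab : State → Set AP
  Tr : State → Act → State → Prop

namespace L2TS

variable {Act : Type a} {AP : Type p}

/-- The associated LTS. -/
def toLTS (M : L2TS.{v} Act AP) : LTS.{v} Act where
  State := M.State
  Tr := M.Tr

/-- The associated Kripke structure. -/
def toKripke (M : L2TS.{v} Act AP) : Kripke.{v} AP where
  State := M.State
  lab := M.lab
  Tr s t := ∃ b, M.Tr s b t

/-- Consistency of a doubly labelled transition system. -/
structure Consistent (M : L2TS.{v} Act AP) (τ : Act) : Prop where
  lab_eq_iff : ∀ {s b t}, M.Tr s b t → (M.lab s = M.lab t ↔ b = τ)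
  lab_target : ∀ {s s' b t t'}, M.Tr s b t → M.Tr s' b t' → M.lab s = M.lab s' →
    M.lab t = M.lab t'
  act_eq : ∀ {s s' b c t t'}, M.Tr s b t → M.Tr s' c t' → M.lab s = M.lab s' →
    M.lab t = M.lab t' → b = c

/-- The extension to L²TSs of branching bisimulation equivalence. -/
def BranchingBisim (M : L2TS.{v} Act AP) (τ : Act) (s t : M.State) : Prop :=
  M.lab s = M.lab t ∧ M.toLTS.BranchingBisim τ s t

/-- The extension to L²TSs of divergence sensitive branching bisimulation equivalence. -/
def DivSensBranchingBisim (M : L2TS.{v} Act AP) (τ : Act) (s t : M.State) : Prop :=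
  M.lab s = M.lab t ∧ M.toLTS.DivSensBranchingBisim τ s t

/-- The extension to L²TSs of branching bisimulation equivalence with explicit divergence. -/
def ExplDivBranchingBisim (M : L2TS.{v} Act AP) (τ : Act) (s t : M.State) : Prop :=
  M.lab s = M.lab t ∧ M.toLTS.ExplDivBranchingBisim τ s t

end L2TS

/-- An LTS-to-L²TS transformation: a map from LTSs to consistent L²TSs, with a map of states, that
preserves and reflects the three branching bisimulation equivalences. -/
structure Transformation {Act : Type a} (τ : Act) (AP : Type p) where
  sys : LTS.{u} Act → L2TS.{v} Act AP
  state : ∀ L : LTS.{u} Act, L.State → (sys L).State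
  consistent : ∀ L : LTS.{u} Act, (sys L).Consistent τ
  branchingBisim_iff : ∀ (L : LTS.{u} Act) (s t : L.State),
    L.BranchingBisim τ s t ↔ (sys L).BranchingBisim τ (state L s) (state L t)
  divSensBranchingBisim_iff : ∀ (L : LTS.{u} Act) (s t : L.State),
    L.DivSensBranchingBisim τ s t ↔ (sys L).DivSensBranchingBisim τ (state L s) (state L t)
  explDivBranchingBisim_iff : ∀ (L : LTS.{u} Act) (s t : L.State),
    L.ExplDivBranchingBisim τ s t ↔ (sys L).ExplDivBranchingBisim τ (state L s) (state L t)

namespace Transformation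

variable {Act : Type a} {τ : Act} {AP : Type p}

/-- The Kripke structure `D(η(L))`. -/
def deadlockKripke (η : Transformation.{u, v} τ AP) (L : LTS.{u} Act) :
    Kripke.{v} (Option AP) :=
  (η.sys L).toKripke.deadlockExt

/-- The state `D∘η(s)` of `D(η(L))`. -/
def deadlockState (η : Transformation.{u, v} τ AP) (L : LTS.{u} Act) (s : L.State) :
    (η.deadlockKripke L).State :=
  some (η.state L s)

/-- `s ⊨ φ` under the translation `D∘η`. -/
def DeadlockValid (η : Transformation.{u, v} τ AP) (L : LTS.{u} Act) (s : L.State)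
    (φ : StateFormula.{v} (Option AP)) : Prop :=
  φ.Valid (K := η.deadlockKripke L) (η.deadlockState L s)

end Transformation

end DeadlockCTL

open DeadlockCTL

-- Since the transformation preserves and reflects the equivalence, everything takes place in a
-- consistent L²TS `M` and its deadlock extension `D(M)`. There every state has a successor, so
-- maximal paths are infinite. The link between bisimulation and logic is the stutter colouring
-- (`Kripke.IsStutterColouring`) of `D(M)`. From equally coloured states, infinite paths can be
-- matched up to stuttering (`exists_stutterEq`).
--
-- From bisimulation to logic: a consistent, divergence preserving colouring of `M`, paired with the
-- labels and with a separate colour for the deadlock state, is a stutter colouring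
-- (`isStutterColouring_deadlockColour`). Without a next operator, formulas cannot tell stutter
-- equivalent infinite paths apart, so equally coloured states satisfy the same formulas.
--
-- From logic to bisimulation: validity of formulas is itself a stutter colouring, because a
-- conjunction over the reachable states singles out a colour (`formulaColour_isStutterColouring`).
-- Conversely, any stutter colouring restricts to a consistent, divergence preserving colouring of
-- `M`: labels determine the actions, so stutter equivalent paths have the same coloured trace
-- (`exists_trace_eq`).

namespace DeadlockCTL

/-! ### Stutter equivalence of infinite sequences -/

section Stutter

variable {Col : Type*}

open Classical in
/-- The number of colour changes among the first `n` steps of a sequence of colours. -/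
noncomputable def changes (c : ℕ → Col) (n : ℕ) : ℕ :=
  Nat.count (fun k => c k ≠ c (k + 1)) n

@[simp] theorem changes_zero (c : ℕ → Col) : changes c 0 = 0 := by
  simp [changes]

theorem changes_succ_of_eq {c : ℕ → Col} {n : ℕ} (h : c n = c (n + 1)) :
    changes c (n + 1) = changes c n := by
  simp [changes, Nat.count_succ, h]

theorem changes_succ_of_ne {c : ℕ → Col} {n : ℕ} (h : c n ≠ c (n + 1)) :
    changes c (n + 1) = changes c n + 1 := by
  simp [changes, Nat.count_succ, h]

theorem changes_mono (c : ℕ → Col) : Monotone (changes c) := by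
  classical
  exact fun _ _ h => Nat.count_monotone _ h

theorem changes_drop (c : ℕ → Col) (k i : ℕ) :
    changes (fun i => c (i + k)) i + changes c k = changes c (i + k) := by
  induction i with
  | zero => simp
  | succ i ih =>
    rw [show i + 1 + k = i + k + 1 by omega]
    by_cases hn : c (i + k) = c (i + k + 1)
    · rw [changes_succ_of_eq hn, ← ih, changes_succ_of_eq]
      rw [hn]; congr 1; omega
    · rw [changes_succ_of_ne hn, ← ih, changes_succ_of_ne]
      · omega
      · rwa [show i + 1 + k = i + k + 1 by omega]

/-- Equal counts leave no change of colour between the two positions. Thus `changes c i` serves as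
the index of the block of constant colour that contains `i`. -/
theorem colour_eq_of_changes_eq {c : ℕ → Col} {i j : ℕ} (h : changes c i = changes c j) :
    c i = c j := by
  wlog hij : i ≤ j generalizing i j
  · exact (this h.symm (by omega)).symm
  induction j, hij using Nat.le_induction with
  | base => rfl
  | succ j hij ih =>
    have h1 := changes_mono c hij
    by_cases hn : c j = c (j + 1)
    · rw [changes_succ_of_eq hn] at h
      rw [ih h, hn]
    · rw [changes_succ_of_ne hn] at h
      omega

/-- The count grows by at most one per step, so no value is skipped; the witness `m` is the last
position of block `n`. -/
theorem exists_change {c : ℕ → Col} {n j : ℕ} (h : n < changes c j) :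
    ∃ m < j, changes c m = n ∧ c m ≠ c (m + 1) := by
  induction j with
  | zero => simp at h
  | succ j ih =>
    by_cases hn : c j = c (j + 1)
    · rw [changes_succ_of_eq hn] at h
      obtain ⟨m, hm, h'⟩ := ih h
      exact ⟨m, by omega, h'⟩
    · rw [changes_succ_of_ne hn] at h
      rcases Nat.lt_succ_iff_lt_or_eq.mp h with h | h
      · obtain ⟨m, hm, h'⟩ := ih h
        exact ⟨m, by omega, h'⟩
      · exact ⟨j, by omega, h.symm, hn⟩

theorem exists_changes_eq {c : ℕ → Col} {n j : ℕ} (h : n ≤ changes c j) :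
    ∃ m ≤ j, changes c m = n := by
  rcases h.lt_or_eq with h | h
  · obtain ⟨m, hm, h', -⟩ := exists_change h
    exact ⟨m, hm.le, h'⟩
  · exact ⟨j, le_rfl, h.symm⟩

/-- Two sequences of colours are stutter equivalent: they run through the same blocks of
constant colour. -/
structure StutterEq (c c' : ℕ → Col) : Prop where
  left : ∀ i, ∃ j, changes c i = changes c' j
  right : ∀ j, ∃ i, changes c i = changes c' j
  colour : ∀ {i j}, changes c i = changes c' j → c i = c' j

theorem StutterEq.symm {c c' : ℕ → Col} (h : StutterEq c c') : StutterEq c' c where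
  left j := (h.right j).imp fun _ h => h.symm
  right i := (h.left i).imp fun _ h => h.symm
  colour e := (h.colour e.symm).symm

theorem StutterEq.drop {c c' : ℕ → Col} (h : StutterEq c c') {k l : ℕ}
    (hkl : changes c k = changes c' l) :
    StutterEq (fun i => c (i + k)) (fun i => c' (i + l)) := by
  have key : ∀ {c c' : ℕ → Col}, StutterEq c c' → ∀ {k l : ℕ}, changes c k = changes c' l →
      ∀ i, ∃ j, changes (fun i => c (i + k)) i = changes (fun i => c' (i + l)) j := by
    intro c c' h k l hkl i
    obtain ⟨j, hj⟩ := h.left (i + k)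
    have h1 := changes_drop c k i
    rcases le_total l j with hl | hl
    · obtain ⟨d, rfl⟩ := Nat.exists_eq_add_of_le' hl
      have h2 := changes_drop c' l d
      exact ⟨d, by omega⟩
    -- Here monotonicity forces `i + k` into the block of `k`, so offset `0` corresponds to `i`.
    · have h2 := changes_mono c' hl
      have h3 := changes_mono c (Nat.le_add_left k i)
      exact ⟨0, by rw [changes_zero]; omega⟩
  refine ⟨key h hkl, fun j => ?_, fun {i j} hij => h.colour ?_⟩
  · exact (key h.symm hkl.symm j).imp fun _ h => h.symm
  · rw [← changes_drop c k i, ← changes_drop c' l j, hij, hkl]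

/-- A position in one of two stutter equivalent sequences has a corresponding position in the
other one such that all earlier positions correspond to earlier positions. -/
theorem StutterEq.exists_first {c c' : ℕ → Col} (h : StutterEq c c') (k : ℕ) :
    ∃ l, changes c k = changes c' l ∧ ∀ j < l, ∃ i < k, changes c i = changes c' j := by
  classical
  have hex := h.left k
  -- The least position of the block is chosen: all earlier ones then lie in strictly earlier
  -- blocks, which the other sequence has visited before `k`.
  refine ⟨Nat.find hex, Nat.find_spec hex, fun j hj => ?_⟩
  have hne := Nat.find_min hex hj
  have hle := changes_mono c' hj.le
  rw [← Nat.find_spec hex] at hle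
  obtain ⟨m, hm, h', -⟩ := exists_change (c := c) (n := changes c' j) (j := k) (by omega)
  exact ⟨m, hm, h'⟩

/-- Every initial segment of one of two stutter equivalent sequences corresponds to an initial
segment of the other one. -/
theorem StutterEq.exists_len {c c' : ℕ → Col} (h : StutterEq c c') (N : ℕ∞) :
    ∃ N' : ℕ∞, (N = ⊤ → N' = ⊤) ∧
      (∀ k : ℕ, (k : ℕ∞) ≤ N → ∃ l : ℕ, (l : ℕ∞) ≤ N' ∧ changes c k = changes c' l) ∧
      ∀ l : ℕ, (l : ℕ∞) ≤ N' → ∃ k : ℕ, (k : ℕ∞) ≤ N ∧ changes c k = changes c' l := by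
  induction N using ENat.recTopCoe with
  | top =>
    exact ⟨⊤, fun _ => rfl, fun k _ => (h.left k).imp fun _ h => ⟨le_top, h⟩,
      fun l _ => (h.right l).imp fun _ h => ⟨le_top, h⟩⟩
  | coe n =>
    obtain ⟨m, hm⟩ := h.left n
    refine ⟨m, fun h => (ENat.natCast_ne_top n h).elim, fun k hk => ?_, fun l hl => ?_⟩
    · obtain ⟨l, hl, h'⟩ := exists_changes_eq (hm ▸ changes_mono c (Nat.cast_le.mp hk))
      exact ⟨l, Nat.cast_le.mpr hl, h'.symm⟩
    · obtain ⟨k, hk, h'⟩ := exists_changes_eq (hm.symm ▸ changes_mono c' (Nat.cast_le.mp hl))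
      exact ⟨k, Nat.cast_le.mpr hk, h'⟩

end Stutter

/-! ### Colourings of Kripke structures -/

namespace Kripke

variable {AP : Type p} {K : Kripke.{v} AP} {Col : Type*}

/-- From a state one can reach a state of colour `c` by `n` transitions within the colour of the
state followed by one further transition. -/
def ColourReach (K : Kripke.{v} AP) (C : K.State → Col) (c : Col) : ℕ → K.State → Prop
  | 0, y => ∃ y', K.Tr y y' ∧ C y' = c
  | n + 1, y => ∃ y', K.Tr y y' ∧ C y' = C y ∧ K.ColourReach C c n y'

/-- A colouring that refines the labelling and satisfies the transfer conditions of
divergence sensitive stuttering equivalence. -/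
structure IsStutterColouring (K : Kripke.{v} AP) (C : K.State → Col) : Prop where
  lab_eq : ∀ {x y}, C x = C y → K.lab x = K.lab y
  reach : ∀ {x x' y}, C x = C y → K.Tr x x' → C x' ≠ C x → ∃ n, K.ColourReach C (C x') n y
  -- One step is enough: the same `f` applies again to `y'`, so a whole infinite run within the
  -- colour can be built.
  div : ∀ {f : ℕ → K.State} {y}, (∀ i, K.Tr (f i) (f (i + 1))) → (∀ i, C (f i) = C (f 0)) →
    C (f 0) = C y → ∃ y', K.Tr y y' ∧ C y' = C y

/-- Infinite paths can be matched, up to stuttering, from any state of the same colour. -/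
theorem IsStutterColouring.exists_stutterEq {C : K.State → Col} (hC : K.IsStutterColouring C)
    {f : ℕ → K.State} (hf : ∀ i, K.Tr (f i) (f (i + 1))) {y : K.State} (hy : C (f 0) = C y) :
    ∃ g : ℕ → K.State, g 0 = y ∧ (∀ i, K.Tr (g i) (g (i + 1))) ∧
      StutterEq (fun i => C (f i)) (fun i => C (g i)) := by
  set c : ℕ → Col := fun i => C (f i) with hc
  -- `Fuel i y r`: if the block of `i` ends, then after `r` steps within its colour one further step
  -- from `y` reaches the colour of the next block. For an infinite block this is vacuous.
  let Fuel (i : ℕ) (y : K.State) (r : ℕ) : Prop :=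
    ∀ k, changes c k = changes c i → c k ≠ c (k + 1) → K.ColourReach C (c (k + 1)) r y
  have hfuel : ∀ i y, c i = C y → ∃ r, Fuel i y r := by
    intro i y hiy
    by_cases h : ∃ k, changes c k = changes c i ∧ c k ≠ c (k + 1)
    · obtain ⟨k, hk, hne⟩ := h
      obtain ⟨r, hr⟩ := hC.reach (x := f k) (x' := f (k + 1)) (y := y)
        ((colour_eq_of_changes_eq hk).trans hiy) (hf k) (Ne.symm hne)
      refine ⟨r, fun k' hk' hne' => ?_⟩
      rwa [colour_eq_of_changes_eq (c := c) (i := k' + 1) (j := k + 1)]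
      rw [changes_succ_of_ne hne, changes_succ_of_ne hne', hk, hk']
    · exact ⟨0, fun k hk hne => (h ⟨k, hk, hne⟩).elim⟩
  -- The matching path is built by iterating on triples: a position in `f`, the current state, and
  -- its remaining fuel.
  let St := {q : ℕ × K.State × ℕ // c q.1 = C q.2.1 ∧ Fuel q.1 q.2.1 q.2.2}
  have hstep : ∀ q : St, ∃ q' : St, K.Tr q.1.2.1 q'.1.2.1 ∧
      ((C q'.1.2.1 = C q.1.2.1 ∧ q'.1.1 = q.1.1 ∧
        ((∃ k, changes c k = changes c q.1.1 ∧ c k ≠ c (k + 1)) → q'.1.2.2 < q.1.2.2)) ∨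
      (C q'.1.2.1 ≠ C q.1.2.1 ∧ changes c q'.1.1 = changes c q.1.1 + 1)) := by
    rintro ⟨⟨i, y, r⟩, hiy, hr⟩
    dsimp only at hiy hr ⊢
    by_cases h : ∃ k, changes c k = changes c i ∧ c k ≠ c (k + 1)
    · obtain ⟨k, hk, hne⟩ := h
      have hki := colour_eq_of_changes_eq hk
      cases r with
      | zero =>
        -- The fuel is spent: this transition enters the next block, where new fuel is provided.
        obtain ⟨y', hyy', hy'⟩ := hr k hk hne
        obtain ⟨r', hr'⟩ := hfuel (k + 1) y' hy'.symm
        refine ⟨⟨(k + 1, y', r'), hy'.symm, hr'⟩, hyy', Or.inr ⟨?_, ?_⟩⟩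
        · dsimp only
          rw [hy', ← hiy, ← hki]
          exact hne.symm
        · rw [changes_succ_of_ne hne, hk]
      | succ r =>
        obtain ⟨y', hyy', hy', hr'⟩ := hr k hk hne
        refine ⟨⟨(i, y', r), hiy.trans hy'.symm, fun k' hk' hne' => ?_⟩, hyy',
          Or.inl ⟨hy', rfl, fun _ => Nat.lt_succ_self r⟩⟩
        rwa [colour_eq_of_changes_eq (c := c) (i := k' + 1) (j := k + 1)]
        rw [changes_succ_of_ne hne, changes_succ_of_ne hne', hk, hk']
    -- The block never ends, so the tail of `f` is an infinite run within one colour and `div`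
    -- supplies the step.
    · have hconst : ∀ j, changes c (j + i) = changes c i := by
        intro j
        induction j with
        | zero => simp
        | succ j ih =>
          have : c (j + i) = c (j + i + 1) := by
            by_contra hne
            exact h ⟨j + i, ih, hne⟩
          rw [← ih, show j + 1 + i = j + i + 1 by omega, changes_succ_of_eq this]
      obtain ⟨y', hyy', hy'⟩ := hC.div (f := fun j => f (j + i)) (y := y)
        (fun j => by rw [show j + 1 + i = j + i + 1 by omega]; exact hf _)
        (fun j => colour_eq_of_changes_eq (c := c) (by rw [hconst, hconst]))
        (by rw [Nat.zero_add]; exact hiy)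
      exact ⟨⟨(i, y', r), hiy.trans hy'.symm, fun k hk hne => (h ⟨k, hk, hne⟩).elim⟩, hyy',
        Or.inl ⟨hy', rfl, fun h' => (h h').elim⟩⟩
  choose nxt hnxt hcase using hstep
  obtain ⟨r, hr⟩ := hfuel 0 y hy
  let q : ℕ → St := fun n => Nat.rec ⟨(0, y, r), hy, hr⟩ (fun _ q => nxt q) n
  have hq : ∀ n, q (n + 1) = nxt (q n) := fun n => rfl
  let g : ℕ → K.State := fun n => (q n).1.2.1
  have hcol : ∀ n, c (q n).1.1 = C (g n) := fun n => (q n).2.1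
  have hcnt : ∀ n, changes c (q n).1.1 = changes (fun i => C (g i)) n := by
    intro n
    induction n with
    | zero => simp [q]
    | succ n ih =>
      rcases hcase (q n) with ⟨h1, h2, -⟩ | ⟨h1, h2⟩
      · rw [changes_succ_of_eq h1.symm, hq, h2, ih]
      · rw [changes_succ_of_ne h1.symm, hq, h2, ih]
  -- While the block of `f` is finite the fuel strictly decreases, so the constructed path
  -- eventually leaves the block too.
  have hprog : ∀ r n, (q n).1.2.2 = r →
      (∃ k, changes c k = changes c (q n).1.1 ∧ c k ≠ c (k + 1)) →
      ∃ m, changes c (q m).1.1 = changes c (q n).1.1 + 1 := by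
    intro r
    induction r using Nat.strong_induction_on with
    | _ r ih =>
      intro n hn hk
      rcases hcase (q n) with ⟨h1, h2, h3⟩ | ⟨h1, h2⟩
      · rw [← hq] at h2
        obtain ⟨m, hm⟩ := ih _ (hn ▸ h3 hk) (n + 1) rfl (by rwa [h2])
        exact ⟨m, by rw [hm, h2]⟩
      · exact ⟨n + 1, h2⟩
  refine ⟨g, rfl, fun i => hnxt (q i), fun i => ?_, fun j => ⟨_, hcnt j⟩, fun {i j} hij => ?_⟩
  · induction i with
    | zero => exact ⟨0, by simp⟩
    | succ i ih =>
      obtain ⟨j, hj⟩ := ih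
      by_cases hi : c i = c (i + 1)
      · exact ⟨j, by rw [changes_succ_of_eq hi, hj]⟩
      · obtain ⟨m, hm⟩ := hprog _ j rfl ⟨i, by rw [hcnt, hj], hi⟩
        exact ⟨m, by rw [← hcnt, hm, hcnt, changes_succ_of_ne hi, hj]⟩
  · rw [← hcnt] at hij
    exact (colour_eq_of_changes_eq hij).trans (hcol j)

end Kripke

/-! ### Stutter invariance of CTL* without next -/

namespace Kripke

variable {AP : Type p} {K : Kripke.{v} AP} {Col : Type*}

/-- The infinite path through a sequence of states. -/
def Path.ofSeq (f : ℕ → K.State) (hf : ∀ i, K.Tr (f i) (f (i + 1))) : K.Path where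
  len := ⊤
  st := f
  step k _ := hf k

theorem Path.ofSeq_maximal (f : ℕ → K.State) (hf : ∀ i, K.Tr (f i) (f (i + 1))) :
    (Path.ofSeq f hf).Maximal :=
  fun n h => (ENat.natCast_ne_top n h.symm).elim

theorem Path.Maximal.len_eq_top (hK : ∀ x, ∃ y, K.Tr x y) {π : K.Path} (h : π.Maximal) :
    π.len = ⊤ := by
  by_contra hne
  obtain ⟨n, hn⟩ := ENat.ne_top_iff_exists.mp hne
  exact h n hn.symm (hK _)

theorem Path.tr_of_len_eq_top {π : K.Path} (h : π.len = ⊤) (i : ℕ) :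
    K.Tr (π.st i) (π.st (i + 1)) :=
  π.step i (by rw [h]; exact ENat.natCast_lt_top i)

theorem Path.drop_len_eq_top {π : K.Path} (h : π.len = ⊤) (k : ℕ) : (π.drop k).len = ⊤ := by
  simp [Path.drop, h]

theorem exists_seq (hK : ∀ x, ∃ y, K.Tr x y) (x : K.State) :
    ∃ f : ℕ → K.State, f 0 = x ∧ ∀ i, K.Tr (f i) (f (i + 1)) := by
  choose nxt h using hK
  exact ⟨fun n => Nat.rec x (fun _ y => nxt y) n, rfl, fun i => h _⟩

end Kripke

section Invariance

variable {AP : Type p} {K : Kripke.{v} AP} {Col : Type*}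

mutual
/-- State formulas do not distinguish states of the same colour. -/
theorem StateFormula.valid_iff_of_colour_eq {C : K.State → Col} (hC : K.IsStutterColouring C)
    (hK : ∀ x, ∃ y, K.Tr x y) :
    ∀ (φ : StateFormula.{v} AP) {x y : K.State}, C x = C y → (φ.Valid x ↔ φ.Valid y)
  | .atom q, x, y, h => by
    simp only [StateFormula.Valid, hC.lab_eq h]
  | .neg φ, x, y, h => by
    simp only [StateFormula.Valid]
    exact not_congr (StateFormula.valid_iff_of_colour_eq hC hK φ h)
  | .conj ι φ, x, y, h => by
    simp only [StateFormula.Valid]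
    exact forall_congr' fun i => StateFormula.valid_iff_of_colour_eq hC hK (φ i) h
  | .ex ψ, x, y, h => by
    have key : ∀ {x y : K.State}, C x = C y →
        (∃ π : K.Path, π.Maximal ∧ π.st 0 = x ∧ ψ.Valid π) →
        ∃ π : K.Path, π.Maximal ∧ π.st 0 = y ∧ ψ.Valid π := by
      rintro x y h ⟨π, hπ, rfl, hψ⟩
      have hlen := hπ.len_eq_top hK
      obtain ⟨g, hg0, hg, hfg⟩ := hC.exists_stutterEq (Kripke.Path.tr_of_len_eq_top hlen) h
      exact ⟨.ofSeq g hg, Kripke.Path.ofSeq_maximal g hg, hg0,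
        (PathFormula.valid_iff_of_stutterEq hC hK ψ hlen rfl hfg).mp hψ⟩
    simp only [StateFormula.Valid]
    exact ⟨key h, key h.symm⟩

/-- Path formulas do not distinguish infinite paths that are stutter equivalent. -/
theorem PathFormula.valid_iff_of_stutterEq {C : K.State → Col} (hC : K.IsStutterColouring C)
    (hK : ∀ x, ∃ y, K.Tr x y) :
    ∀ (ψ : PathFormula.{v} AP) {π π' : K.Path}, π.len = ⊤ → π'.len = ⊤ →
      StutterEq (fun i => C (π.st i)) (fun i => C (π'.st i)) → (ψ.Valid π ↔ ψ.Valid π')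
  | .state φ, π, π', _, _, h => by
    simp only [PathFormula.Valid]
    exact StateFormula.valid_iff_of_colour_eq hC hK φ (h.colour (i := 0) (j := 0) (by simp))
  | .neg ψ, π, π', hl, hl', h => by
    simp only [PathFormula.Valid]
    exact not_congr (PathFormula.valid_iff_of_stutterEq hC hK ψ hl hl' h)
  | .conj ι ψ, π, π', hl, hl', h => by
    simp only [PathFormula.Valid]
    exact forall_congr' fun i => PathFormula.valid_iff_of_stutterEq hC hK (ψ i) hl hl' h
  | .until ψ₁ ψ₂, π, π', hl, hl', h => by
    have key : ∀ {π π' : K.Path}, π.len = ⊤ → π'.len = ⊤ →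
        StutterEq (fun i => C (π.st i)) (fun i => C (π'.st i)) →
        (∃ k : ℕ, (k : ℕ∞) ≤ π.len ∧ ψ₂.Valid (π.drop k) ∧ ∀ j < k, ψ₁.Valid (π.drop j)) →
        ∃ k : ℕ, (k : ℕ∞) ≤ π'.len ∧ ψ₂.Valid (π'.drop k) ∧ ∀ j < k, ψ₁.Valid (π'.drop j) := by
      rintro π π' hl hl' h ⟨k, -, h2, h1⟩
      obtain ⟨l, hkl, hlt⟩ := h.exists_first k
      refine ⟨l, by simp [hl'], ?_, fun j hj => ?_⟩
      · exact (PathFormula.valid_iff_of_stutterEq hC hK ψ₂ (Kripke.Path.drop_len_eq_top hl k)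
          (Kripke.Path.drop_len_eq_top hl' l) (h.drop hkl)).mp h2
      · obtain ⟨i, hi, hij⟩ := hlt j hj
        exact (PathFormula.valid_iff_of_stutterEq hC hK ψ₁ (Kripke.Path.drop_len_eq_top hl i)
          (Kripke.Path.drop_len_eq_top hl' j) (h.drop hij)).mp (h1 i hi)
    simp only [PathFormula.Valid]
    exact ⟨key hl hl' h, key hl' hl h.symm⟩
end

end Invariance

/-! ### The colouring by validity of formulas -/

section Formulas

variable {AP : Type p} {K : Kripke.{v} AP}

/-- Two states satisfy the same formulas with conjunctions of size less than `κ`. -/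
def Kripke.formulaSetoid (K : Kripke.{v} AP) (κ : Cardinal.{v}) : Setoid K.State where
  r x y := ∀ φ : StateFormula.{v} AP, φ.ConjLT κ → (φ.Valid x ↔ φ.Valid y)
  iseqv := ⟨fun _ _ _ => Iff.rfl, fun h φ hφ => (h φ hφ).symm,
    fun h h' φ hφ => (h φ hφ).trans (h' φ hφ)⟩

/-- The colouring by validity of the formulas with conjunctions of size less than `κ`. -/
def Kripke.formulaColour (K : Kripke.{v} AP) (κ : Cardinal.{v}) (x : K.State) :
    Quotient (K.formulaSetoid κ) :=
  Quotient.mk _ x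

theorem Kripke.formulaColour_eq_iff {κ : Cardinal.{v}} {x y : K.State} :
    K.formulaColour κ x = K.formulaColour κ y ↔
      ∀ φ : StateFormula.{v} AP, φ.ConjLT κ → (φ.Valid x ↔ φ.Valid y) :=
  Quotient.eq

/-- A state satisfies a formula that is characteristic for its colour among the states
reachable from `y`. -/
theorem Kripke.exists_characteristic {κ : Cardinal.{v}} (hκ : 0 < κ) (x y : K.State)
    (hy : Cardinal.mk {z // Relation.ReflTransGen K.Tr y z} < κ) :
    ∃ φ : StateFormula.{v} AP, φ.ConjLT κ ∧ φ.Valid x ∧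
      ∀ z, Relation.ReflTransGen K.Tr y z → φ.Valid z →
        K.formulaColour κ z = K.formulaColour κ x := by
  -- Closure under negation allows each distinguishing formula to be oriented so that it holds at
  -- `x`.
  have h : ∀ z : K.State, ∃ φ : StateFormula.{v} AP, φ.ConjLT κ ∧ φ.Valid x ∧
      (φ.Valid z → K.formulaColour κ z = K.formulaColour κ x) := by
    intro z
    by_cases hz : K.formulaColour κ z = K.formulaColour κ x
    -- The empty conjunction serves as truth.
    · exact ⟨.conj PEmpty PEmpty.elim, by simpa [StateFormula.ConjLT] using hκ,
        by simp [StateFormula.Valid], fun _ => hz⟩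
    · have hz' := hz
      rw [Kripke.formulaColour_eq_iff] at hz'
      push Not at hz'
      obtain ⟨φ, hφ, ⟨h1, h2⟩ | ⟨h1, h2⟩⟩ := hz'
      · exact ⟨.neg φ, by simpa [StateFormula.ConjLT] using hφ, by simpa [StateFormula.Valid],
          fun h => by simp [StateFormula.Valid, h1] at h⟩
      · exact ⟨φ, hφ, h2, fun h => (h1 h).elim⟩
  choose φ h1 h2 h3 using h
  -- Only states reachable from `y` contribute conjuncts, which keeps their number below `κ`.
  refine ⟨.conj {z // Relation.ReflTransGen K.Tr y z} fun z => φ z, ?_, ?_, fun z hz hv => ?_⟩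
  · simp only [StateFormula.ConjLT]
    exact ⟨hy, fun z => h1 z⟩
  · simp only [StateFormula.Valid]
    exact fun z => h2 z
  · simp only [StateFormula.Valid] at hv
    exact h3 z (hv ⟨z, hz⟩)

theorem Kripke.reflTransGen_of_seq {g : ℕ → K.State} (hg : ∀ i, K.Tr (g i) (g (i + 1))) (i : ℕ) :
    Relation.ReflTransGen K.Tr (g 0) (g i) := by
  induction i with
  | zero => exact .refl
  | succ i ih => exact ih.tail (hg i)

theorem Kripke.colourReach_of_seq {Col : Type*} {C : K.State → Col} {c : Col} {n : ℕ}
    {g : ℕ → K.State} (hg : ∀ i ≤ n, K.Tr (g i) (g (i + 1))) (hn : ∀ i ≤ n, C (g i) = C (g 0))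
    (hc : C (g (n + 1)) = c) : K.ColourReach C c n (g 0) := by
  induction n generalizing g with
  | zero => exact ⟨g 1, hg 0 le_rfl, hc⟩
  | succ n ih =>
    refine ⟨g 1, hg 0 (by omega), hn 1 (by omega), ih (g := fun i => g (i + 1))
      (fun i hi => hg (i + 1) (by omega)) ?_ hc⟩
    exact fun i hi => (hn (i + 1) (by omega)).trans (hn 1 (by omega)).symm

/-- With `φ`, `φ'` characteristic for the colours of `x`, `x'`, the formula `∃ (φ U φ')` transfers a
step to a new colour, and `∃ ¬(true U ¬φ)` transfers an infinite run within a colour. It suffices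
that they are characteristic among states reachable from `y`, since paths from `y` visit no others.
-/
theorem Kripke.formulaColour_isStutterColouring (hK : ∀ x, ∃ y, K.Tr x y) {κ : Cardinal.{v}}
    (hκ : 0 < κ) (hreach : ∀ x, Cardinal.mk {y // Relation.ReflTransGen K.Tr x y} < κ) :
    K.IsStutterColouring (K.formulaColour κ) where
  lab_eq h := by
    ext q
    simpa [StateFormula.Valid] using
      Kripke.formulaColour_eq_iff.mp h (.atom q) (by simp [StateFormula.ConjLT])
  reach {x x' y} hxy hxx' hne := by
    obtain ⟨φ, hφ, hφx, hφc⟩ := Kripke.exists_characteristic hκ x y (hreach y)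
    obtain ⟨φ', hφ', hφx', hφc'⟩ := Kripke.exists_characteristic hκ x' y (hreach y)
    have h := Kripke.formulaColour_eq_iff.mp hxy (.ex (.until (.state φ) (.state φ')))
      (by simpa [StateFormula.ConjLT, PathFormula.ConjLT] using ⟨hφ, hφ'⟩)
    simp only [StateFormula.Valid, PathFormula.Valid, Kripke.Path.drop, Nat.zero_add] at h
    -- By totality the step from `x` to `x'` extends to an infinite path, which satisfies the until
    -- formula at position `1`.
    obtain ⟨f, hf0, hf⟩ := Kripke.exists_seq hK x'
    have hf' : ∀ i, K.Tr ((Nat.casesOn i x f : K.State)) (f i) := by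
      rintro (_ | i)
      · exact hf0 ▸ hxx'
      · exact hf i
    obtain ⟨π, hπ, rfl, k, -, hk, hlt⟩ := h.mp
      ⟨.ofSeq (fun i => (Nat.casesOn i x f : K.State)) hf', Kripke.Path.ofSeq_maximal _ _, rfl, 1,
        by simp [Kripke.Path.ofSeq], by simpa [Kripke.Path.ofSeq, hf0] using hφx',
        fun j hj => by
          obtain rfl : j = 0 := by omega
          exact hφx⟩
    have hg := Kripke.Path.tr_of_len_eq_top (hπ.len_eq_top hK)
    have hk' := hφc' _ (Kripke.reflTransGen_of_seq hg k) hk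
    cases k with
    -- Position `0` would give `y` the colour of `x'`, which differs from that of `x`.
    | zero => exact (hne (hk'.symm.trans hxy.symm)).elim
    | succ n =>
      exact ⟨n, Kripke.colourReach_of_seq (fun i _ => hg i) (fun i hi =>
        (hφc _ (Kripke.reflTransGen_of_seq hg i) (hlt i (by omega))).trans hxy) hk'⟩
  div {f y} hf hconst hxy := by
    obtain ⟨φ, hφ, hφx, hφc⟩ := Kripke.exists_characteristic hκ (f 0) y (hreach y)
    have h := Kripke.formulaColour_eq_iff.mp hxy
      (.ex (.neg (.until (.conj PEmpty PEmpty.elim) (.neg (.state φ)))))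
      (by simpa [StateFormula.ConjLT, PathFormula.ConjLT] using ⟨hκ, hφ⟩)
    simp only [StateFormula.Valid, PathFormula.Valid, Kripke.Path.drop, Nat.zero_add] at h
    obtain ⟨π, hπ, rfl, hv⟩ := h.mp
      ⟨.ofSeq f hf, Kripke.Path.ofSeq_maximal _ _, rfl, by
        rintro ⟨k, -, hk, -⟩
        exact hk ((Kripke.formulaColour_eq_iff.mp (hconst k) φ hφ).mpr hφx)⟩
    have hlen := hπ.len_eq_top hK
    have hg := Kripke.Path.tr_of_len_eq_top hlen
    refine ⟨π.st 1, hg 0, (hφc _ (Kripke.reflTransGen_of_seq hg 1) ?_).trans hxy⟩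
    by_contra h1
    exact hv ⟨1, by simp [hlen], h1, fun j _ => by rintro ⟨⟩⟩

end Formulas

/-! ### Coloured traces -/

namespace LTS

variable {Act : Type a} {L : LTS.{u} Act} {τ : Act} {Col : Type*} {C : L.State → Col}

open Classical in
-- Trades `Nat.nth` and the cardinality test for counting: entry `n` stems from the visible
-- transition preceded by exactly `n` visible ones.
theorem Path.trace_eq_some_iff (π : L.Path) {n : ℕ} {q : Act × Col} :
    (π.trace τ C).2 n = some q ↔ ∃ m, π.Visible τ C m ∧ Nat.count (π.Visible τ C) m = n ∧
      q = (π.act m, C (π.st (m + 1))) := by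
  have hlt : (n : ℕ∞) < {k | π.Visible τ C k}.encard ↔
      ∀ hf : {k | π.Visible τ C k}.Finite, n < hf.toFinset.card := by
    by_cases hf : {k | π.Visible τ C k}.Finite
    · rw [hf.encard_eq_coe_toFinset_card, Nat.cast_lt]
      exact ⟨fun h _ => h, fun h => h hf⟩
    · rw [Set.Infinite.encard_eq hf]
      exact ⟨fun _ h => (hf h).elim, fun _ => ENat.natCast_lt_top n⟩
  simp only [Path.trace]
  constructor
  · intro h
    split_ifs at h with hn
    exact ⟨_, Nat.nth_mem n (hlt.mp hn), Nat.count_nth (hlt.mp hn), (Option.some.inj h).symm⟩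
  · rintro ⟨m, hm, rfl, rfl⟩
    rw [if_pos (hlt.mpr fun hf => Nat.count_lt_card hf hm), Nat.nth_count hm]

/-- In a system where invisible steps are the steps within a colour and where the action of a step
is determined by the colours, paths with stutter equivalent colours have the same trace. -/
theorem Path.trace_eq_of_stutterEq (hτ : ∀ {s b t}, L.Tr s b t → C s = C t → b = τ)
    (hact : ∀ {s s' b b' t t'}, L.Tr s b t → L.Tr s' b' t' → C s = C s' → C t = C t' → b = b')
    {π π' : L.Path} {c c' : ℕ → Col} (hc : ∀ k : ℕ, (k : ℕ∞) ≤ π.len → C (π.st k) = c k)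
    (hc' : ∀ k : ℕ, (k : ℕ∞) ≤ π'.len → C (π'.st k) = c' k) (h : StutterEq c c')
    (hl : ∀ k : ℕ, (k : ℕ∞) ≤ π.len → ∃ l : ℕ, (l : ℕ∞) ≤ π'.len ∧ changes c k = changes c' l)
    (hl' : ∀ l : ℕ, (l : ℕ∞) ≤ π'.len → ∃ k : ℕ, (k : ℕ∞) ≤ π.len ∧ changes c k = changes c' l) :
    π.trace τ C = π'.trace τ C := by
  classical
  -- On the path, visible transitions are exactly the colour changes, so `changes` counts them.
  -- Beyond a finite path, `c` may continue arbitrarily.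
  have hvis : ∀ {π : L.Path} {c : ℕ → Col}, (∀ k : ℕ, (k : ℕ∞) ≤ π.len → C (π.st k) = c k) →
      ∀ {k : ℕ}, (k : ℕ∞) < π.len → (π.Visible τ C k ↔ c k ≠ c (k + 1)) := by
    intro π c hc k hk
    rw [← hc k hk.le, ← hc (k + 1) (Order.add_one_le_of_lt hk)]
    exact ⟨fun h e => h.2 ⟨hτ (π.step k hk) e, e⟩, fun h => ⟨hk, fun e => h e.2⟩⟩
  have hcount : ∀ {π : L.Path} {c : ℕ → Col}, (∀ k : ℕ, (k : ℕ∞) ≤ π.len → C (π.st k) = c k) →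
      ∀ {k : ℕ}, (k : ℕ∞) ≤ π.len → Nat.count (π.Visible τ C) k = changes c k := by
    intro π c hc k hk
    induction k with
    | zero => simp
    | succ k ih =>
      have hk' : (k : ℕ∞) < π.len :=
        lt_of_lt_of_le (Nat.cast_lt.mpr (Nat.lt_succ_self k)) hk
      by_cases hn : c k = c (k + 1)
      · rw [changes_succ_of_eq hn, Nat.count_succ, ih hk'.le,
          if_neg (by rw [hvis hc hk']; exact not_not.mpr hn)]
        rfl
      · rw [changes_succ_of_ne hn, Nat.count_succ, ih hk'.le, if_pos ((hvis hc hk').mpr hn)]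
  have key : ∀ {π π' : L.Path} {c c' : ℕ → Col},
      (∀ k : ℕ, (k : ℕ∞) ≤ π.len → C (π.st k) = c k) →
      (∀ k : ℕ, (k : ℕ∞) ≤ π'.len → C (π'.st k) = c' k) → StutterEq c c' →
      (∀ k : ℕ, (k : ℕ∞) ≤ π.len → ∃ l : ℕ, (l : ℕ∞) ≤ π'.len ∧ changes c k = changes c' l) →
      ∀ {n q}, (π.trace τ C).2 n = some q → (π'.trace τ C).2 n = some q := by
    intro π π' c c' hc hc' h hl n q hq
    rw [Path.trace_eq_some_iff] at hq ⊢
    obtain ⟨m, hm, hmn, rfl⟩ := hq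
    have hm1 : ((m + 1 : ℕ) : ℕ∞) ≤ π.len := Order.add_one_le_of_lt hm.1
    have hne := (hvis hc hm.1).mp hm
    obtain ⟨l, hl1, hl2⟩ := hl (m + 1) hm1
    rw [changes_succ_of_ne hne] at hl2
    -- The corresponding change happens before `l`, hence still on `π'`.
    obtain ⟨m', hm'l, hm', hne'⟩ := exists_change (c := c') (n := changes c m) (j := l) (by omega)
    have hlt' : (m' : ℕ∞) < π'.len := lt_of_lt_of_le (Nat.cast_lt.mpr hm'l) hl1
    have hle' : ((m' + 1 : ℕ) : ℕ∞) ≤ π'.len := Order.add_one_le_of_lt hlt'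
    have h0 : C (π.st m) = C (π'.st m') := by
      rw [hc m hm.1.le, hc' m' hlt'.le, h.colour hm'.symm]
    have h1 : C (π.st (m + 1)) = C (π'.st (m' + 1)) := by
      rw [hc _ hm1, hc' _ hle', h.colour]
      rw [changes_succ_of_ne hne, changes_succ_of_ne hne', hm']
    refine ⟨m', (hvis hc' hlt').mpr hne', ?_, ?_⟩
    · rw [hcount hc' hlt'.le, hm', ← hcount hc hm.1.le, hmn]
    · rw [h1, hact (π.step m hm.1) (π'.step m' hlt') h0 h1]
  refine Prod.ext ?_ (funext fun n => Option.ext fun q => ⟨key hc hc' h hl, ?_⟩)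
  · simp only [Path.trace]
    rw [hc 0 (by simp), hc' 0 (by simp), h.colour (i := 0) (j := 0) (by simp)]
  · exact key hc' hc h.symm fun k hk => (hl' k hk).imp fun _ h => ⟨h.1, h.2.symm⟩

/-- A visible transition is answered by an equally coloured state, after invisible steps. -/
theorem Consistent.exists_answer (hC : L.Consistent τ C) {x x' y : L.State} {b : Act}
    (hxy : C x = C y) (hx : L.Tr x b x') (hvis : ¬ (b = τ ∧ C x = C x')) :
    ∃ (n : ℕ) (g : ℕ → L.State), g 0 = y ∧
      (∀ k < n, L.Tr (g k) τ (g (k + 1)) ∧ C (g k) = C (g (k + 1))) ∧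
      L.Tr (g n) b (g (n + 1)) ∧ C (g (n + 1)) = C x' := by
  classical
  -- A one-step path whose only trace entry is the given transition. On a path from `y` with the
  -- same trace, entry `0` is the first visible transition, so all steps before it are invisible.
  let π : L.Path :=
    { len := 1
      st := fun k => Nat.casesOn k x fun _ => x'
      act := fun _ => b
      step := fun k hk => by
        obtain rfl : k = 0 := by
          have : k < 1 := by exact_mod_cast hk
          omega
        exact hx }
  obtain ⟨π', hπ0, hπ⟩ : π.trace τ C ∈ L.traces τ C y := hC x y hxy ▸ ⟨π, rfl, rfl⟩
  have h := π.trace_eq_some_iff (τ := τ) (C := C).mpr ⟨0, ⟨by simp [π], hvis⟩, rfl, rfl⟩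
  rw [← hπ, Path.trace_eq_some_iff] at h
  obtain ⟨m, hm, hm0, he⟩ := h
  obtain ⟨hb, hx'⟩ := Prod.mk.inj he
  refine ⟨m, π'.st, hπ0, fun k hk => ?_, ?_, hx'.symm⟩
  · have hk' : (k : ℕ∞) < π'.len := (Nat.cast_lt.mpr hk).trans hm.1
    have hnv : ¬ π'.Visible τ C k := by
      intro hv
      have := Nat.count_strict_mono hv hk
      simp only [Nat.count_zero] at hm0
      omega
    have hnv' : π'.act k = τ ∧ C (π'.st k) = C (π'.st (k + 1)) := by
      by_contra h
      exact hnv ⟨hk', h⟩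
    exact ⟨hnv'.1 ▸ π'.step k hk', hnv'.2⟩
  · have : π'.act m = b := hb.symm
    exact this ▸ π'.step m hm.1

/-- Divergence within a colour is answered by an invisible step. -/
theorem PreservesDivergence.exists_answer (hC : L.PreservesDivergence τ C) {f : ℕ → L.State}
    (hf : ∀ i, L.Tr (f i) τ (f (i + 1))) (hconst : ∀ i, C (f i) = C (f (i + 1))) {y : L.State}
    (hy : C (f 0) = C y) : ∃ y', L.Tr y τ y' ∧ C y = C y' := by
  -- The trace of this run has no entries, so a matching infinite path from `y` is invisible
  -- throughout and its first step is the answer.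
  let π : L.Path := ⟨⊤, f, fun _ => τ, fun k _ => hf k⟩
  have hnone : ∀ n, (π.trace τ C).2 n = none := by
    refine fun n => Option.eq_none_iff_forall_ne_some.mpr fun q hq => ?_
    rw [Path.trace_eq_some_iff] at hq
    obtain ⟨m, hm, -⟩ := hq
    exact hm.2 ⟨rfl, hconst m⟩
  obtain ⟨-, π', hπ0, hlen, hπ⟩ : π.trace τ C ∈ L.divergentTraces τ C y :=
    hC (f 0) y hy ▸ ⟨⟨0, hnone 0⟩, π, rfl, rfl, rfl⟩
  have h0 : ((0 : ℕ) : ℕ∞) < π'.len := by simp [hlen]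
  have hinv : π'.act 0 = τ ∧ C (π'.st 0) = C (π'.st 1) := by
    classical
    by_contra h
    have := (π'.trace_eq_some_iff (τ := τ) (C := C)).mpr ⟨0, ⟨h0, h⟩, rfl, rfl⟩
    rw [hπ, hnone] at this
    simp at this
  subst hπ0
  exact ⟨π'.st 1, hinv.1 ▸ π'.step 0 h0, hinv.2⟩

end LTS

/-! ### The deadlock extension of a doubly labelled transition system -/

theorem Kripke.deadlockExt_total {AP : Type p} (K : Kripke.{v} AP) :
    ∀ x : K.deadlockExt.State, ∃ y, K.deadlockExt.Tr x y
  | none => ⟨none, trivial⟩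
  | some s => by
    by_cases h : ∃ t, K.Tr s t
    · exact h.elim fun t ht => ⟨some t, ht⟩
    · exact ⟨none, h⟩

theorem Kripke.deadlockExt_lab_some_ne {AP : Type p} (K : Kripke.{v} AP) (s : K.State) :
    K.deadlockExt.lab (some s) ≠ K.deadlockExt.lab none := by
  intro h
  have : none ∈ K.deadlockExt.lab (some s) := h ▸ Set.mem_singleton _
  obtain ⟨_, -, h⟩ := this
  exact Option.some_ne_none _ h

theorem Kripke.deadlockExt_lab_some_inj {AP : Type p} (K : Kripke.{v} AP) {s t : K.State}
    (h : K.deadlockExt.lab (some s) = K.deadlockExt.lab (some t)) : K.lab s = K.lab t :=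
  Set.image_injective.mpr (Option.some_injective _) h

namespace L2TS

variable {Act : Type a} {AP : Type p} {M : L2TS.{v} Act AP} {τ : Act} {Col : Type*}

/-- The colouring of the deadlock extension induced by a colouring of the states of an L²TS. -/
def deadlockColour (M : L2TS.{v} Act AP) (C : M.State → Col) :
    M.toKripke.deadlockExt.State → Option (Set AP × Col) :=
  -- The label is included because `C` alone need not refine the labelling.
  Option.map fun x => (M.lab x, C x)

theorem deadlockColour_some_eq_iff {C : M.State → Col} {x y : M.State} :
    M.deadlockColour C (some x) = M.deadlockColour C (some y) ↔ M.lab x = M.lab y ∧ C x = C y := by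
  change some _ = some _ ↔ _
  rw [Option.some_inj, Prod.mk.injEq]

theorem deadlockColour_some_ne_none {C : M.State → Col} {x : M.State} :
    M.deadlockColour C (some x) ≠ M.deadlockColour C none :=
  Option.some_ne_none _

/-- Where a state is deadlocked, each equally coloured state can reach a deadlock within its
colour. -/
theorem Consistent.colourReach_deadlock (hM : M.Consistent τ) {C : M.State → Col}
    (hC : M.toLTS.Consistent τ C) (hD : M.toLTS.PreservesDivergence τ C) {x y : M.State}
    (hxy : M.lab x = M.lab y ∧ C x = C y) (hx : ¬ ∃ b x', M.Tr x b x') :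
    ∃ n, M.toKripke.deadlockExt.ColourReach (M.deadlockColour C) none n (some y) := by
  by_contra hy
  -- These states form a divergence: none is deadlocked, and a visible step would have to be
  -- answered from the deadlocked `x`, so each has an invisible step, which stays in `Q`. Divergence
  -- preservation then yields a step from `x`.
  let Q := {z : M.State // (M.lab x = M.lab z ∧ C x = C z) ∧
    ¬ ∃ n, M.toKripke.deadlockExt.ColourReach (M.deadlockColour C) none n (some z)}
  have hstep : ∀ z : Q, ∃ z' : Q, M.Tr z.1 τ z'.1 := by
    rintro ⟨z, ⟨hl, hc⟩, hz⟩
    have htr : ∃ z' b, M.Tr z b z' := by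
      by_contra h
      exact hz ⟨0, none, h, rfl⟩
    obtain ⟨z', b, hb⟩ := htr
    have hinv : b = τ ∧ C z = C z' := by
      by_contra hvis
      obtain ⟨n, g, rfl, hg, hgn, -⟩ := hC.exists_answer hc.symm hb hvis
      cases n with
      | zero => exact hx ⟨_, _, hgn⟩
      | succ n => exact hx ⟨_, _, (hg 0 (by omega)).1⟩
    obtain ⟨rfl, hcz⟩ := hinv
    have hlz := (hM.lab_eq_iff hb).mpr rfl
    refine ⟨⟨z', ⟨hl.trans hlz, hc.trans hcz⟩, ?_⟩, hb⟩
    rintro ⟨n, hn⟩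
    exact hz ⟨n + 1, some z', ⟨b, hb⟩,
      deadlockColour_some_eq_iff.mpr ⟨hlz.symm, hcz.symm⟩, hn⟩
  choose nxt hnxt using hstep
  let f : ℕ → Q := fun n => Nat.rec ⟨y, hxy, hy⟩ (fun _ q => nxt q) n
  obtain ⟨x', hx', -⟩ := hD.exists_answer (f := fun n => (f n).1) (fun i => hnxt (f i))
    (fun i => (f i).2.1.2.symm.trans (f (i + 1)).2.1.2) hxy.2.symm
  exact hx ⟨_, _, hx'⟩

/-- A consistent divergence preserving colouring of a consistent L²TS induces a colouring of the
deadlock extension that satisfies the transfer conditions of stuttering equivalence. -/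
theorem Consistent.isStutterColouring_deadlockColour (hM : M.Consistent τ) {C : M.State → Col}
    (hC : M.toLTS.Consistent τ C) (hD : M.toLTS.PreservesDivergence τ C) :
    M.toKripke.deadlockExt.IsStutterColouring (M.deadlockColour C) where
  lab_eq {x y} h := by
    rcases x with _ | x <;> rcases y with _ | y
    · rfl
    · exact (deadlockColour_some_ne_none h.symm).elim
    · exact (deadlockColour_some_ne_none h).elim
    · exact congrArg (some '' ·) (deadlockColour_some_eq_iff.mp h).1
  reach {x x' y} hxy hx hne := by
    rcases x with _ | x
    · rcases x' with _ | x'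
      · exact (hne rfl).elim
      · exact hx.elim
    rcases y with _ | y
    · exact (deadlockColour_some_ne_none hxy).elim
    have hxy := deadlockColour_some_eq_iff.mp hxy
    rcases x' with _ | x'
    · exact hM.colourReach_deadlock hC hD hxy fun ⟨b, x', h⟩ => hx ⟨x', b, h⟩
    obtain ⟨b, hb⟩ := hx
    have hvis : ¬ (b = τ ∧ C x = C x') := fun ⟨h1, h2⟩ =>
      hne (deadlockColour_some_eq_iff.mpr ⟨((hM.lab_eq_iff hb).mpr h1).symm, h2.symm⟩)
    obtain ⟨n, g, rfl, hg, hgn, hgc⟩ := hC.exists_answer hxy.2 hb hvis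
    have hg0 : ∀ i ≤ n, M.lab (g i) = M.lab (g 0) ∧ C (g i) = C (g 0) := by
      intro i hi
      induction i with
      | zero => exact ⟨rfl, rfl⟩
      | succ i ih =>
        have h := hg i (by omega)
        have ih := ih (by omega)
        exact ⟨((hM.lab_eq_iff h.1).mpr rfl).symm.trans ih.1, h.2.symm.trans ih.2⟩
    refine ⟨n, Kripke.colourReach_of_seq (K := M.toKripke.deadlockExt) (g := fun i => some (g i))
      (fun i hi => ?_) (fun i hi => deadlockColour_some_eq_iff.mpr (hg0 i hi)) ?_⟩
    · rcases hi.lt_or_eq with h | rfl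
      · exact ⟨_, (hg i h).1⟩
      · exact ⟨_, hgn⟩
    -- In a consistent L²TS the source label and the action determine the target label.
    · exact deadlockColour_some_eq_iff.mpr
        ⟨hM.lab_target hgn hb ((hg0 n le_rfl).1.trans hxy.1.symm), hgc⟩
  div {f y} hf hconst hy := by
    rcases y with _ | y
    · exact ⟨none, trivial, rfl⟩
    have hsome : ∀ i, ∃ z, f i = some z := by
      intro i
      rcases h : f i with _ | z
      · exact (deadlockColour_some_ne_none (hy.symm.trans ((hconst i).symm.trans (h ▸ rfl)))).elim
      · exact ⟨z, rfl⟩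
    choose g hg using hsome
    have hcol : ∀ i, M.lab (g i) = M.lab y ∧ C (g i) = C y := fun i =>
      deadlockColour_some_eq_iff.mp (hg i ▸ (hconst i).trans hy)
    have htr : ∀ i, M.Tr (g i) τ (g (i + 1)) := by
      intro i
      have h := hf i
      rw [hg, hg] at h
      obtain ⟨b, hb⟩ := h
      obtain rfl := (hM.lab_eq_iff hb).mp ((hcol i).1.trans (hcol (i + 1)).1.symm)
      exact hb
    obtain ⟨y', hyy', hy'⟩ := hD.exists_answer htr
      (fun i => (hcol i).2.trans (hcol (i + 1)).2.symm) (hcol 0).2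
    exact ⟨some y', ⟨τ, hyy'⟩,
      deadlockColour_some_eq_iff.mpr ⟨((hM.lab_eq_iff hyy').mpr rfl).symm, hy'.symm⟩⟩

/-- Each path of an L²TS is the initial part of an infinite path of its deadlock extension. -/
theorem exists_deadlockExt_seq (π : M.toLTS.Path) :
    ∃ f : ℕ → M.toKripke.deadlockExt.State,
      (∀ i, M.toKripke.deadlockExt.Tr (f i) (f (i + 1))) ∧
      ∀ i : ℕ, (i : ℕ∞) ≤ π.len → f i = some (π.st i) := by
  by_cases hlen : π.len = ⊤
  · exact ⟨fun i => some (π.st i), fun i => ⟨_, π.step i (hlen ▸ ENat.natCast_lt_top i)⟩,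
      fun i _ => rfl⟩
  obtain ⟨n, hn⟩ := ENat.ne_top_iff_exists.mp hlen
  -- A finite path need not be maximal; any infinite continuation in the total extension will do.
  obtain ⟨h, h0, hh⟩ := Kripke.exists_seq M.toKripke.deadlockExt_total (some (π.st n))
  let f : ℕ → M.toKripke.deadlockExt.State := fun i => if i ≤ n then some (π.st i) else h (i - n)
  have hle : ∀ {i}, i ≤ n → f i = some (π.st i) := fun hi => if_pos hi
  have hge : ∀ i, f (i + n) = h i := by
    rintro (_ | i)
    · rw [Nat.zero_add]
      exact (hle le_rfl).trans h0.symm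
    · exact (if_neg (by omega)).trans (congrArg h (by omega))
  refine ⟨f, fun i => ?_, fun i hi => hle (by rwa [← hn, Nat.cast_le] at hi)⟩
  rcases lt_or_ge i n with hi | hi
  · rw [hle hi.le, hle hi]
    exact ⟨_, π.step i (hn ▸ Nat.cast_lt.mpr hi)⟩
  · obtain ⟨d, rfl⟩ := Nat.exists_eq_add_of_le' hi
    rw [hge, Nat.add_right_comm, hge]
    exact hh d

/-- A stutter colouring of the deadlock extension matches coloured traces of the L²TS. -/
theorem Consistent.exists_trace_eq (hM : M.Consistent τ)
    {C : M.toKripke.deadlockExt.State → Col} (hC : M.toKripke.deadlockExt.IsStutterColouring C)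
    (π : M.toLTS.Path) {y : M.State} (hy : C (some (π.st 0)) = C (some y)) :
    ∃ π' : M.toLTS.Path, π'.st 0 = y ∧ (π.len = ⊤ → π'.len = ⊤) ∧
      π'.trace τ (fun s => C (some s)) = π.trace τ (fun s => C (some s)) := by
  have hlab : ∀ {s t : M.State}, C (some s) = C (some t) → M.lab s = M.lab t := fun h =>
    M.toKripke.deadlockExt_lab_some_inj (hC.lab_eq h)
  obtain ⟨f, hf, hfπ⟩ := M.exists_deadlockExt_seq π
  obtain ⟨g, hg0, hg, hfg⟩ := hC.exists_stutterEq hf (y := some y)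
    (by rw [hfπ 0 (by simp)]; exact hy)
  -- The infinite match is cut off at a length corresponding to that of `π`.
  obtain ⟨N, hN, hl, hl'⟩ := hfg.exists_len π.len
  have hsome : ∀ i : ℕ, ∃ z : M.State, (i : ℕ∞) ≤ N → g i = some z := by
    -- Up to `N`, `g` only shows colours of states of `M`; the label of the deadlock state excludes
    -- it there. The value `y` beyond `N` is a dummy.
    intro i
    by_cases hi : (i : ℕ∞) ≤ N
    · obtain ⟨k, hk, hki⟩ := hl' i hi
      have hcol := hfg.colour hki
      rw [hfπ k hk] at hcol
      rcases h : g i with _ | z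
      · rw [h] at hcol
        exact (M.toKripke.deadlockExt_lab_some_ne _ (hC.lab_eq hcol)).elim
      · exact ⟨z, fun _ => rfl⟩
    · exact ⟨y, fun h => (hi h).elim⟩
  choose st hst using hsome
  have hact : ∀ i : ℕ, ∃ b : Act, (i : ℕ∞) < N → M.Tr (st i) b (st (i + 1)) := by
    intro i
    by_cases hi : (i : ℕ∞) < N
    · have h := hg i
      rw [hst i hi.le, hst (i + 1) (Order.add_one_le_of_lt hi)] at h
      obtain ⟨b, hb⟩ := h
      exact ⟨b, fun _ => hb⟩
    · exact ⟨τ, fun h => (hi h).elim⟩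
  choose act hact using hact
  refine ⟨⟨N, st, act, hact⟩, Option.some.inj ((hst 0 (by simp)).symm.trans hg0), hN, ?_⟩
  exact (LTS.Path.trace_eq_of_stutterEq (c := fun i => C (f i)) (c' := fun i => C (g i))
    (fun h e => (hM.lab_eq_iff h).mp (hlab e))
    (fun h h' e e' => hM.act_eq h h' (hlab e) (hlab e'))
    (fun k hk => congrArg C (hfπ k hk).symm) (fun k hk => congrArg C (hst k hk).symm)
    hfg hl hl').symm

theorem Consistent.consistent_of_isStutterColouring (hM : M.Consistent τ)
    {C : M.toKripke.deadlockExt.State → Col} (hC : M.toKripke.deadlockExt.IsStutterColouring C) :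
    M.toLTS.Consistent τ (fun s => C (some s)) := by
  have key : ∀ {s t : M.State}, C (some s) = C (some t) →
      M.toLTS.traces τ (fun s => C (some s)) s ⊆ M.toLTS.traces τ (fun s => C (some s)) t := by
    rintro s t h _ ⟨π, rfl, rfl⟩
    obtain ⟨π', h0, -, hπ⟩ := hM.exists_trace_eq hC π h
    exact ⟨π', h0, hπ⟩
  exact fun s t h => (key h).antisymm (key h.symm)

theorem Consistent.preservesDivergence_of_isStutterColouring (hM : M.Consistent τ)
    {C : M.toKripke.deadlockExt.State → Col} (hC : M.toKripke.deadlockExt.IsStutterColouring C) :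
    M.toLTS.PreservesDivergence τ (fun s => C (some s)) := by
  have key : ∀ {s t : M.State}, C (some s) = C (some t) →
      M.toLTS.divergentTraces τ (fun s => C (some s)) s ⊆
        M.toLTS.divergentTraces τ (fun s => C (some s)) t := by
    rintro s t h _ ⟨hfin, π, rfl, hlen, rfl⟩
    obtain ⟨π', h0, hN, hπ⟩ := hM.exists_trace_eq hC π h
    exact ⟨hfin, π', h0, hN hlen, hπ⟩
  exact fun s t h => (key h).antisymm (key h.symm)

/-- Equivalent states of a consistent L²TS satisfy the same formulas in the deadlock extension. -/
theorem ExplDivBranchingBisim.valid_iff (hM : M.Consistent τ) {s t : M.State}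
    (h : M.ExplDivBranchingBisim τ s t) (φ : StateFormula.{v} (Option AP)) :
    φ.Valid (K := M.toKripke.deadlockExt) (some s) ↔
      φ.Valid (K := M.toKripke.deadlockExt) (some t) := by
  obtain ⟨hlab, Col, C, hC, hD, hst⟩ := h
  exact StateFormula.valid_iff_of_colour_eq (hM.isStutterColouring_deadlockColour hC hD)
    M.toKripke.deadlockExt_total φ (deadlockColour_some_eq_iff.mpr ⟨hlab, hst⟩)

/-- States of a consistent L²TS that satisfy the same formulas with conjunctions of size less than
`κ` are equivalent, where fewer than `κ` states are reachable from each state. -/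
theorem Consistent.explDivBranchingBisim_of_valid_iff (hM : M.Consistent τ) {κ : Cardinal.{v}}
    (hκ : 0 < κ) (hreach : ∀ x : M.toKripke.deadlockExt.State,
      Cardinal.mk {y // Relation.ReflTransGen M.toKripke.deadlockExt.Tr x y} < κ) {s t : M.State}
    (h : ∀ φ : StateFormula.{v} (Option AP), φ.ConjLT κ →
      (φ.Valid (K := M.toKripke.deadlockExt) (some s) ↔
        φ.Valid (K := M.toKripke.deadlockExt) (some t))) :
    M.ExplDivBranchingBisim τ s t := by
  have hC := Kripke.formulaColour_isStutterColouring M.toKripke.deadlockExt_total hκ hreach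
  have hst := Kripke.formulaColour_eq_iff.mpr h
  exact ⟨M.toKripke.deadlockExt_lab_some_inj (hC.lab_eq hst), _, _,
    hM.consistent_of_isStutterColouring hC, hM.preservesDivergence_of_isStutterColouring hC, hst⟩

end L2TS

end DeadlockCTL

theorem mainTheorem5 {Act : Type a} {AP : Type p} (τ : Act)
    (η : Transformation.{u, v} τ AP) (L : LTS.{u} Act) (s t : L.State) :
    (L.ExplDivBranchingBisim τ s t ↔
      ∀ φ : StateFormula.{v} (Option AP), η.DeadlockValid L s φ ↔ η.DeadlockValid L t φ) ∧
    (∀ κ : Cardinal.{v}, Cardinal.aleph0 ≤ κ →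
      (∀ x : (η.deadlockKripke L).State,
        Cardinal.mk {y // Relation.ReflTransGen (η.deadlockKripke L).Tr x y} < κ) →
      (L.ExplDivBranchingBisim τ s t ↔
        ∀ φ : StateFormula.{v} (Option AP), φ.ConjLT κ →
          (η.DeadlockValid L s φ ↔ η.DeadlockValid L t φ))) := by
  rw [η.explDivBranchingBisim_iff]
  have hM := η.consistent L
  refine ⟨⟨fun h φ => h.valid_iff hM φ, fun h => ?_⟩, fun κ hκ hreach =>
    ⟨fun h φ _ => h.valid_iff hM φ, fun h => ?_⟩⟩
  -- The unrestricted case is an instance of the bounded one: the successor of the number of all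
  -- states bounds every reachable set.
  · exact hM.explDivBranchingBisim_of_valid_iff
      (κ := Order.succ (Cardinal.mk (η.deadlockKripke L).State)) (Order.bot_lt_succ _)
      (fun x => Order.lt_succ_of_le (Cardinal.mk_subtype_le _)) fun φ _ => h φ
  · exact hM.explDivBranchingBisim_of_valid_iff (Cardinal.aleph0_pos.trans_le hκ) hreach h
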